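/- Let $E$ and $F$ be complex Banach spaces, let $U\subseteq E$ be open, let $1<p\le\infty$, and let $p^*\in[1,\infty)$ be given by $\frac1p+\frac1{p^*}=1$. Write $X^*$ for the topological dual of a normed space $X$ and $B_X$ for its closed unit ball. Let $\mathcal H^\infty(U,F)$ be the space of bounded holomorphic mappings from $U$ to $F$, with $\|f\|_\infty=\sup_{x\in U}\|f(x)\|$. A holomorphic mapping $f\colon U\to F$ is *Cohen strongly $p$-summing* if there is a constant $C\ge 0$ such that, for all $n\in\mathbb N$, $\lambda_1,\dots,\lambda_n\in\mathbb C$, $x_1,\dots,x_n\in U$ and $y_1^*,\dots,y_n^*\in F^*$, $$\sum_{i=1}^n|\lambda_i|\,|y_i^*(f(x_i))|\le C\,\|(\lambda_i)_{i=1}^n\|_{\ell_p^n}\,\sup_{y^{**}\in B_{F^{**}}}\Big(\sum_{i=1}^n|y^{**}(y_i^*)|^{p^*}\Big)^{1/p^*},$$ and $d_p^{\mathcal H^\infty}(f)$ denotes the infimum of such $C$. Let $\kappa_F\colon F\to F^{**}$ be the canonical embedding. Equip $B_{F^{**}}$ with the weak-star topology $w^*$, and let $\iota_{F^*}\colon F^*\to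 C(B_{F^{**}})$ be the canonical isometric injection $\iota_{F^*}(y^*)(y^{**})=y^{**}(y^*)$. For a regular Borel probability measure $\mu$ on $(B_{F^{**}},w^*)$ let $j_{p^*}\colon C(B_{F^{**}})\to L_{p^*}(\mu)$ be the canonical map. **Theorem (Pietsch factorization).** Let $f\in\mathcal H^\infty(U,F)$. The following are equivalent: (i) $f$ is Cohen strongly $p$-summing. (ii) There exist a regular Borel probability measure $\mu$ on $(B_{F^{**}},w^*)$, a closed subspace $S_{p^*}$ of $L_{p^*}(\mu)$ with $j_{p^*}(\iota_{F^*}(F^*))\subseteq S_{p^*}$, and a bounded holomorphic mapping $g\colon U\to (S_{p^*})^*$ such that $$\kappa_F\circ f=(\iota_{F^*})^*\circ(j_{p^*})^*\circ g ,$$ where $\iota_{F^*}$ is regarded as an operator $F^*\to\iota_{F^*}(F^*)$ and $j_{p^*}$ as an operator $\iota_{F^*}(F^*)\to S_{p^*}$. In this case, $d_p^{\mathcal H^\infty}(f)$ is the minimum of $\|g\|_\infty$ over all factorizations $(\mu,S_{p^*},g)$ as in (ii): every such factorization satisfies $d_p^{\mathcal H^\infty}(f)\le\|g\|_\infty$,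 and equality holds for some factorization. -/

import Mathlib

open scoped ENNReal
open MeasureTheory

noncomputable section

/-- Mathlib's `ENNReal.conjExponent p = 1 + (p - 1)⁻¹` is the conjugate index `p^*`: it equals
`p / (p - 1)` for `1 < p < ∞`, `∞` for `p = 1`, and `1` for `p = ∞`. -/
instance fact_one_le_conjExponent (p : ℝ≥0∞) : Fact (1 ≤ p.conjExponent) :=
  ⟨le_self_add⟩

section DualBall

variable (X : Type*) [NormedAddCommGroup X] [NormedSpace ℂ X]

/-- The closed unit ball `B_{X^*}` of the dual of `X`, as a subset of the dual with its
weak-star topology. -/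
def dualBallSet : Set (WeakDual ℂ X) :=
  WeakDual.toStrongDual ⁻¹' Metric.closedBall 0 1

/-- The space `(B_{X^*}, w^*)`. -/
abbrev DualBall : Type _ := dualBallSet X

instance DualBall.compactSpace : CompactSpace (DualBall X) :=
  isCompact_iff_compactSpace.mp (WeakDual.isCompact_closedBall (𝕜 := ℂ) (E := X) 0 1)

/-- `B_{X^*}` carries the Borel σ-algebra of the weak-star topology. -/
instance DualBall.measurableSpace : MeasurableSpace (DualBall X) := borel (DualBall X)

instance DualBall.borelSpace : BorelSpace (DualBall X) := ⟨rfl⟩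

/-- The canonical isometric injection `ι_X : X → C(B_{X^*})`, `⟨ι_X x, x^*⟩ = x^* x`. -/
def iotaMap : X →ₗᵢ[ℂ] C(DualBall X, ℂ) where
  toFun x := ⟨fun φ => φ.1 x, (WeakDual.eval_continuous x).comp continuous_subtype_val⟩
  map_add' x y := by ext φ; exact map_add (WeakDual.toStrongDual φ.1) x y
  map_smul' c x := by ext φ; exact map_smul (WeakDual.toStrongDual φ.1) c x
  norm_map' x := by
    refine le_antisymm ?_ ?_
    · refine (ContinuousMap.norm_le _ (norm_nonneg x)).2 fun φ => ?_
      have h : ‖WeakDual.toStrongDual φ.1‖ ≤ 1 := mem_closedBall_zero_iff.1 φ.2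
      exact (WeakDual.toStrongDual φ.1).le_of_opNorm_le h x |>.trans (by simp)
    · obtain ⟨g, hg, hgx⟩ := exists_dual_vector'' ℂ x
      have h := ContinuousMap.norm_coe_le_norm
        (⟨fun φ => φ.1 x, (WeakDual.eval_continuous x).comp continuous_subtype_val⟩ :
          C(DualBall X, ℂ))
        ⟨StrongDual.toWeakDual g, mem_closedBall_zero_iff.2 hg⟩
      have h2 : ‖g x‖ = ‖x‖ := by rw [hgx]; simp
      exact h2.symm.le.trans h

/-- The subspace `ι_X(X)` of `C(B_{X^*})`. -/
abbrev iotaRange : Submodule ℂ C(DualBall X, ℂ) :=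
  LinearMap.range (iotaMap X).toLinearMap

/-- `ι_X` regarded as an operator from `X` onto `ι_X(X)`. -/
def iotaToRange : X →L[ℂ] iotaRange X :=
  (iotaMap X).toContinuousLinearMap.codRestrict (iotaRange X) fun x => ⟨x, rfl⟩

end DualBall

/-- The Banach space adjoint `T^* : B^* → A^*`, `T^* φ = φ ∘ T`. -/
def dualOp {A B : Type*} [NormedAddCommGroup A] [NormedSpace ℂ A]
    [NormedAddCommGroup B] [NormedSpace ℂ B] (T : A →L[ℂ] B) :
    StrongDual ℂ B →L[ℂ] StrongDual ℂ A :=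
  ContinuousLinearMap.precomp ℂ T

/-- The canonical map `j_q : C(B_{X^*}) → L_q(μ)`, restricted to an operator from `ι_X(X)` into
a subspace `S` of `L_q(μ)` that contains `j_q(ι_X(X))`. -/
def jRestrict {X : Type*} [NormedAddCommGroup X] [NormedSpace ℂ X] (q : ℝ≥0∞) [Fact (1 ≤ q)]
    (μ : Measure (DualBall X)) [IsFiniteMeasure μ] (S : Submodule ℂ (Lp ℂ q μ))
    (hS : ∀ h : iotaRange X, ContinuousMap.toLp q μ ℂ (h : C(DualBall X, ℂ)) ∈ S) :
    iotaRange X →L[ℂ] S :=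
  ((ContinuousMap.toLp q μ ℂ).comp (iotaRange X).subtypeL).codRestrict S hS

section Holomorphic

variable {E F : Type*} [NormedAddCommGroup E] [NormedSpace ℂ E]
  [NormedAddCommGroup F] [NormedSpace ℂ F]

/-- `f` restricts to an element of `H^∞(U, F)` (for `U` open): it is holomorphic and bounded
on `U`. Values of `f` outside `U` are irrelevant. -/
def IsHInfty (U : Set E) (f : E → F) : Prop :=
  DifferentiableOn ℂ f U ∧ Bornology.IsBounded (f '' U)

/-- The supremum norm `‖f‖_∞ = sup {‖f x‖ : x ∈ U}`. -/
def supNorm (U : Set E) (f : E → F) : ℝ := ⨆ x : U, ‖f x‖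

/-- The weak norm `sup_{y^{**} ∈ B_{F^{**}}} ‖(y^{**}(y_i^*))_i‖_{ℓ_q^n}` of a finite family of
functionals. -/
def weakLpNorm (q : ℝ≥0∞) {n : ℕ} (y : Fin n → StrongDual ℂ F) : ℝ :=
  ⨆ φ : DualBall (StrongDual ℂ F), ‖WithLp.toLp q (fun i => φ.1 (y i))‖

/-- `C` is a constant in the defining inequality of Cohen strongly `p`-summing mappings. The norm
of `WithLp.toLp p c` is the `ℓ_p^n` norm, which is the maximum for `p = ∞`. -/
def IsCohenConst (p : ℝ≥0∞) (U : Set E) (f : E → F) (C : ℝ) : Prop :=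
  0 ≤ C ∧ ∀ (n : ℕ) (c : Fin n → ℂ) (x : Fin n → E) (y : Fin n → StrongDual ℂ F),
    (∀ i, x i ∈ U) →
      ∑ i, ‖c i‖ * ‖y i (f (x i))‖ ≤ C * ‖WithLp.toLp p c‖ * weakLpNorm p.conjExponent y

/-- `f : U → F` is a Cohen strongly `p`-summing holomorphic mapping. -/
def IsCohenStronglySumming (p : ℝ≥0∞) (U : Set E) (f : E → F) : Prop :=
  DifferentiableOn ℂ f U ∧ ∃ C : ℝ, IsCohenConst p U f C

/-- `d_p^{H^∞}(f)`, the infimum of the constants in the defining inequality. -/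
def cohenNorm (p : ℝ≥0∞) (U : Set E) (f : E → F) : ℝ := sInf {C : ℝ | IsCohenConst p U f C}

/-- `(μ, S, g)` is a factorization of `f`: the measure `μ` is a regular Borel probability measure
on `(B_{F^{**}}, w^*)`, `S` is a closed subspace of `L_{p^*}(μ)` containing
`j_{p^*}(ι_{F^*}(F^*))`, the mapping `g : U → S^*` is bounded and holomorphic, and
`κ_F ∘ f = (ι_{F^*})^* ∘ (j_{p^*})^* ∘ g` on `U`. -/
def IsPietschFactorization (p : ℝ≥0∞) (U : Set E) (f : E → F)
    (μ : Measure (DualBall (StrongDual ℂ F))) (S : Submodule ℂ (Lp ℂ p.conjExponent μ))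
    (g : E → StrongDual ℂ S) : Prop :=
  ∃ (_ : IsProbabilityMeasure μ) (_ : μ.Regular)
    (hS : ∀ h : iotaRange (StrongDual ℂ F),
      ContinuousMap.toLp p.conjExponent μ ℂ (h : C(DualBall (StrongDual ℂ F), ℂ)) ∈ S),
    IsClosed (S : Set (Lp ℂ p.conjExponent μ)) ∧ IsHInfty U g ∧
    ∀ x ∈ U, NormedSpace.inclusionInDoubleDual ℂ F (f x) =
      dualOp (iotaToRange (StrongDual ℂ F)) (dualOp (jRestrict p.conjExponent μ S hS) (g x))

end Holomorphic

end

/-! Everything passes through Pietsch domination: for `C ≥ 0`, `f` satisfies the defining inequality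
with constant `C` iff some regular probability measure `μ` gives `|y*(f x)| ≤ C ‖j ι y*‖` in
`L_{p*}(μ)` for all `x ∈ U` and all `y*`.

To find `μ`, the converse of Hölder removes the scalars `λ_i`, leaving `∑ |y_i*(f x_i)|^{p*} ≤
C^{p*} sup_φ ∑ |φ(y_i*)|^{p*}`. By weak-star compactness the supremum is attained, so every
nonnegative combination of the functions `φ ↦ C^{p*} |φ(y*)|^{p*} - |y*(f x)|^{p*}` is nonnegative
somewhere. Hahn-Banach separation and Riesz representation then give one measure for which all their
means are nonnegative (`IsCohenConst.exists_measure`).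

Domination says exactly that `j ι y* ↦ y*(f x)` is a well-defined functional of norm at most `C` on
`j ι(F*)`. Extended to the closure, it is `g x`; holomorphy is inherited from `x ↦ y*(f x)`, since
bounded weak-star holomorphic maps are holomorphic. Conversely, a factorization gives domination
with `C = ‖g‖_∞`, and Hölder plus integration of the weak norm gives the inequality. No step loses a
constant and the infimum of constants is attained, hence the minimum. -/

/-! ### Separation and Riesz representation on a compact space -/

/-- **Riesz representation on a compact space** for a positive unital functional. -/
theorem exists_probabilityMeasure_integral_eq {K : Type*} [TopologicalSpace K] [CompactSpace K]
    [T2Space K] [MeasurableSpace K] [BorelSpace K] (l : C(K, ℝ) →ₗ[ℝ] ℝ)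
    (hl : ∀ h : C(K, ℝ), 0 ≤ h → 0 ≤ l h) (hl1 : l 1 = 1) :
    ∃ μ : Measure K, IsProbabilityMeasure μ ∧ μ.Regular ∧
      ∀ h : C(K, ℝ), ∫ φ, h φ ∂μ = l h := by
  let T : CompactlySupportedContinuousMap K ℝ →ₗ[ℝ] ℝ :=
    { toFun := fun h => l h.toContinuousMap
      map_add' := fun a b => l.map_add a.toContinuousMap b.toContinuousMap
      map_smul' := fun a b => l.map_smul a b.toContinuousMap }
  let Λ := PositiveLinearMap.mk₀ T fun h hh => hl h.toContinuousMap hh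
  have hint : ∀ h : C(K, ℝ), ∫ φ, h φ ∂(RealRMK.rieszMeasure Λ) = l h := fun h =>
    RealRMK.integral_rieszMeasure Λ (CompactlySupportedContinuousMap.continuousMapEquiv h)
  refine ⟨RealRMK.rieszMeasure Λ, ?_, inferInstance, hint⟩
  have h1 := hint 1
  rw [hl1] at h1
  simp only [ContinuousMap.one_apply, integral_const, smul_eq_mul, mul_one] at h1
  refine ⟨?_⟩
  have := (ENNReal.toReal_eq_one_iff _).1 h1
  exact this

/-- If every nonnegative combination of the functions `h i` is nonnegative at some point of the
compact space `K`, then all of them have nonnegative mean with respect to a single regular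
probability measure. -/
theorem exists_probabilityMeasure_integral_nonneg {K ι : Type*} [TopologicalSpace K]
    [CompactSpace K] [T2Space K] [MeasurableSpace K] [BorelSpace K] (h : ι → C(K, ℝ))
    (hh : ∀ (s : Finset ι) (w : ι → ℝ), (∀ i, 0 ≤ w i) → ∃ φ, 0 ≤ ∑ i ∈ s, w i * h i φ) :
    ∃ μ : Measure K, IsProbabilityMeasure μ ∧ μ.Regular ∧ ∀ i, 0 ≤ ∫ φ, h i φ ∂μ := by
  obtain ⟨φ₀, -⟩ := hh ∅ 0 fun _ => le_rfl
  let N : Set C(K, ℝ) := {k | ∀ φ, k φ < 0}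
  let A : Set C(K, ℝ) := {k | ∃ (s : Finset ι) (w : ι → ℝ), (∀ i, 0 ≤ w i) ∧
    k = ∑ i ∈ s, w i • h i}
  have hN : IsOpen N := by
    have := ContinuousMap.isOpen_setOfPred_mapsTo (X := K) isCompact_univ (isOpen_Iio (a := (0 : ℝ)))
    simpa [Set.MapsTo] using this
  have hNc : Convex ℝ N := by
    intro a ha b hb s t hs ht hst φ
    have h1 : s * a φ + t * b φ < 0 := by
      rcases hs.eq_or_lt with rfl | hs
      · have : t = 1 := by linarith
        subst this
        simpa using hb φ
      · nlinarith [mul_pos hs (neg_pos.2 (ha φ)), mul_nonneg ht (neg_pos.2 (hb φ)).le]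
    simpa using h1
  have hA : Convex ℝ A := by
    classical
    rintro _ ⟨s, w, hw, rfl⟩ _ ⟨t, v, hv, rfl⟩ a b ha hb -
    refine ⟨s ∪ t, fun i => a * (if i ∈ s then w i else 0) + b * (if i ∈ t then v i else 0),
      fun i => ?_, ?_⟩
    · have := hw i
      have := hv i
      dsimp only
      split_ifs <;> positivity
    · simp_rw [add_smul, Finset.sum_add_distrib, Finset.smul_sum, ← smul_smul, ite_smul, zero_smul,
        smul_ite, smul_zero]
      congr 1
      · rw [← Finset.sum_filter]
        congr 1
        ext i
        simp +contextual
      · rw [← Finset.sum_filter]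
        congr 1
        ext i
        simp +contextual
  have hdisj : Disjoint N A := by
    rw [Set.disjoint_left]
    rintro _ hk ⟨s, w, hw, rfl⟩
    obtain ⟨φ, hφ⟩ := hh s w hw
    have := hk φ
    simp only [ContinuousMap.coe_sum, Finset.sum_apply, ContinuousMap.coe_smul, Pi.smul_apply,
      smul_eq_mul] at this
    exact absurd this (not_lt.2 hφ)
  -- The separating level turns out to be `0`: `u ≤ 0` because `0 ∈ A`, and `u ≥ 0` because small
  -- negative constants lie in `N`.
  obtain ⟨l, u, hlN, hlA⟩ := geometric_hahn_banach_open hNc hN hA hdisj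
  have hu : u ≤ 0 := by
    simpa using hlA 0 ⟨∅, 0, fun _ => le_rfl, by simp⟩
  have hneg : ∀ c : ℝ, 0 < c → -c * l 1 < u := fun c hc => by
    have := hlN (-c • 1) fun φ => by simpa using hc
    simpa using this
  have hl1 : 0 < l 1 := by
    have := hneg 1 one_pos
    linarith
  have hu0 : 0 ≤ u := by
    by_contra! hu0
    have := hneg (-u / (2 * l 1)) (by apply div_pos <;> linarith)
    field_simp at this
    linarith
  have hpos : ∀ k : C(K, ℝ), 0 ≤ k → 0 ≤ l k := by
    intro k hk
    refine le_of_forall_pos_le_add fun ε hε => ?_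
    have hδ : 0 < ε / l 1 := div_pos hε hl1
    -- Subtracting a small constant makes `-k` strictly negative; it is scaled to cost exactly `ε`
    -- under `l`.
    have := hlN (-(k + (ε / l 1) • 1)) fun φ => by
      have h1 : 0 ≤ k φ := hk φ
      simp
      linarith
    simp only [map_neg, map_add, map_smul, smul_eq_mul, div_mul_cancel₀ _ hl1.ne'] at this
    linarith
  obtain ⟨μ, hμ, hreg, hint⟩ := exists_probabilityMeasure_integral_eq
    ((l 1)⁻¹ • (l : C(K, ℝ) →ₗ[ℝ] ℝ))
    (fun k hk => mul_nonneg (inv_nonneg.2 hl1.le) (hpos k hk)) (inv_mul_cancel₀ hl1.ne')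
  refine ⟨μ, hμ, hreg, fun i => ?_⟩
  rw [hint]
  exact mul_nonneg (inv_nonneg.2 hl1.le) (hu0.trans (hlA _ ⟨{i}, 1, fun _ => zero_le_one, by simp⟩))

/-! ### Holomorphy of bounded weak-star holomorphic mappings -/

/-- Second order Taylor estimate along a complex line, from the Schwarz lemma. -/
theorem norm_sub_sub_smul_deriv_le {V : Type*} [NormedAddCommGroup V] [NormedSpace ℂ V]
    [CompleteSpace V] {φ : ℂ → V} {R M : ℝ} (hφ : DifferentiableOn ℂ φ (Metric.ball 0 R))
    (hM : ∀ z ∈ Metric.ball (0 : ℂ) R, ‖φ z‖ ≤ M) {z : ℂ} (hz : z ∈ Metric.ball 0 R) :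
    ‖φ z - φ 0 - z • deriv φ 0‖ ≤ 4 * M / R ^ 2 * ‖z‖ ^ 2 := by
  have hR : 0 < R := Metric.pos_of_mem_ball hz
  have h0 : (0 : ℂ) ∈ Metric.ball (0 : ℂ) R := Metric.mem_ball_self hR
  have hnhds : Metric.ball (0 : ℂ) R ∈ nhds (0 : ℂ) := Metric.ball_mem_nhds _ hR
  have schwarz : ∀ (ψ : ℂ → V) (L : ℝ), DifferentiableOn ℂ ψ (Metric.ball 0 R) →
      (∀ z ∈ Metric.ball (0 : ℂ) R, ‖ψ z‖ ≤ L) →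
      ∀ z ∈ Metric.ball (0 : ℂ) R, ‖dslope ψ 0 z‖ ≤ 2 * L / R := by
    intro ψ L hψ hL z hz
    refine Complex.norm_dslope_le_div_of_mapsTo_ball hψ (fun w hw => ?_) hz
    rw [mem_closedBall_iff_norm]
    calc ‖ψ w - ψ 0‖ ≤ ‖ψ w‖ + ‖ψ 0‖ := norm_sub_le _ _
      _ ≤ 2 * L := by linarith [hL w hw, hL 0 h0]
  have h1 := schwarz φ M hφ hM
  -- Each passage to a difference quotient costs a factor `2 / R`; two of them give `4 * M / R ^ 2`.
  have h2 := schwarz (dslope φ 0) (2 * M / R) ((Complex.differentiableOn_dslope hnhds).2 hφ) h1 z hz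
  have key : φ z - φ 0 - z • deriv φ 0 = z • z • dslope (dslope φ 0) 0 z := by
    have e1 := sub_smul_dslope φ 0 z
    have e2 := sub_smul_dslope (dslope φ 0) 0 z
    rw [sub_zero] at e1 e2
    rw [e2, smul_sub, e1, dslope_same]
  rw [key, norm_smul, norm_smul]
  calc ‖z‖ * (‖z‖ * ‖dslope (dslope φ 0) 0 z‖) ≤ ‖z‖ * (‖z‖ * (2 * (2 * M / R) / R)) := by gcongr
    _ = 4 * M / R ^ 2 * ‖z‖ ^ 2 := by field_simp; ring

/-- A bounded weak-star holomorphic mapping into a dual space is holomorphic. -/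
theorem differentiableOn_strongDual_of_apply {E D : Type*} [NormedAddCommGroup E]
    [NormedSpace ℂ E] [NormedAddCommGroup D] [NormedSpace ℂ D] {U : Set E} (hU : IsOpen U)
    {g : E → StrongDual ℂ D} {C : ℝ} (hC : ∀ x ∈ U, ‖g x‖ ≤ C)
    (hg : ∀ s, DifferentiableOn ℂ (fun x => g x s) U) : DifferentiableOn ℂ g U := by
  intro x hx
  obtain ⟨R, hR, hRU⟩ := Metric.isOpen_iff.1 hU x hx
  have hC0 : 0 ≤ C := (norm_nonneg _).trans (hC x hx)
  have hd : ∀ s, DifferentiableAt ℂ (fun x => g x s) x := fun s =>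
    (hg s).differentiableAt (hU.mem_nhds hx)
  have hbd : ∀ (s : D), ∀ v ∈ U, ‖g v s‖ ≤ C * ‖s‖ := fun s v hv => (g v).le_of_opNorm_le (hC v hv) s
  have hline : ∀ (h : E) (s : D) (r : ℝ), r * ‖h‖ ≤ R →
      DifferentiableOn ℂ (fun t : ℂ => g (x + t • h) s) (Metric.ball 0 r) ∧
      ∀ t ∈ Metric.ball (0 : ℂ) r, ‖g (x + t • h) s‖ ≤ C * ‖s‖ := by
    intro h s r hr
    have hmem : ∀ t ∈ Metric.ball (0 : ℂ) r, x + t • h ∈ U := by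
      intro t ht
      rw [mem_ball_zero_iff] at ht
      apply hRU
      rw [mem_ball_iff_norm, add_sub_cancel_left, norm_smul]
      rcases eq_or_ne h 0 with rfl | hh
      · simpa using hR
      · exact (mul_lt_mul_of_pos_right ht (norm_pos_iff.2 hh)).trans_le hr
    refine ⟨(hg s).comp (by fun_prop) hmem, fun t ht => hbd s _ (hmem t ht)⟩
  have hderiv : ∀ (h : E) (s : D),
      deriv (fun t : ℂ => g (x + t • h) s) 0 = fderiv ℂ (fun x => g x s) x h := by
    intro h s
    have h1 : HasFDerivAt (fun x => g x s) (fderiv ℂ (fun x => g x s) x) (x + (0 : ℂ) • h) := by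
      simpa using (hd s).hasFDerivAt
    have h2 : HasDerivAt (fun t : ℂ => x + t • h) h 0 := by
      simpa using ((hasDerivAt_id (0 : ℂ)).smul_const h).const_add x
    exact (h1.comp_hasDerivAt (0 : ℂ) h2).deriv
  have hfd : ∀ (h : E) (s : D), ‖fderiv ℂ (fun x => g x s) x h‖ ≤ 2 * C / R * ‖h‖ * ‖s‖ := by
    intro h s
    rcases eq_or_ne h 0 with rfl | hh
    · simp
    have hh : 0 < ‖h‖ := norm_pos_iff.2 hh
    have hr : 0 < R / ‖h‖ := by positivity
    obtain ⟨hd1, hb1⟩ := hline h s (R / ‖h‖) (by field_simp; exact le_rfl)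
    have := Complex.norm_deriv_le_div_of_mapsTo_ball (R₂ := 2 * (C * ‖s‖)) hd1 (fun t ht => ?_) hr
    · rw [hderiv] at this
      refine this.trans_eq ?_
      field_simp
    · rw [mem_closedBall_iff_norm]
      calc _ ≤ ‖g (x + t • h) s‖ + ‖g (x + (0 : ℂ) • h) s‖ := norm_sub_le _ _
        _ ≤ _ := by linarith [hb1 t ht, hb1 0 (Metric.mem_ball_self hr)]
  -- The candidate derivative collects the derivatives of the scalar maps; the Cauchy bound `hfd`
  -- makes it bounded.
  let L : E →L[ℂ] StrongDual ℂ D := LinearMap.mkContinuous₂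
    (LinearMap.mk₂ ℂ (fun h s => fderiv ℂ (fun x => g x s) x h)
      (fun _ _ _ => map_add _ _ _) (fun _ _ _ => map_smul _ _ _)
      (fun h s t => by
        have := (hd s).hasFDerivAt.add (hd t).hasFDerivAt
        have e : (fun x => g x (s + t)) = (fun x => g x s) + fun x => g x t := by
          ext; simp
        rw [e, this.fderiv]; rfl)
      (fun c h s => by
        have := (hd s).hasFDerivAt.const_smul c
        have e : (fun x => g x (c • s)) = c • fun x => g x s := by
          ext; simp
        rw [e, this.fderiv]; rfl)) (2 * C / R) hfd
  refine DifferentiableAt.differentiableWithinAt (HasFDerivAt.differentiableAt (f' := L) ?_)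
  rw [hasFDerivAt_iff_isLittleO_nhds_zero]
  refine Asymptotics.IsBigO.trans_isLittleO (g := fun h : E => ‖h‖ ^ 2) ?_ ?_
  · refine Asymptotics.IsBigO.of_bound (4 * C / R ^ 2) ?_
    filter_upwards [Metric.ball_mem_nhds (0 : E) hR] with h hh
    rw [mem_ball_zero_iff] at hh
    refine ContinuousLinearMap.opNorm_le_bound _ (by positivity) fun s => ?_
    rcases eq_or_ne h 0 with rfl | hh0
    · simp
    have hh0 : 0 < ‖h‖ := norm_pos_iff.2 hh0
    -- The Taylor estimate is used at `t = 1`, inside the disc of radius `R / ‖h‖ > 1`. The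
    -- remainder is `O(‖h‖ ^ 2)` with a constant linear in `‖s‖`, so it is small in operator norm.
    obtain ⟨hd1, hb1⟩ := hline h s (R / ‖h‖) (by field_simp; exact le_rfl)
    have hmem : (1 : ℂ) ∈ Metric.ball (0 : ℂ) (R / ‖h‖) := by
      rw [mem_ball_zero_iff, norm_one]
      exact (one_lt_div hh0).2 hh
    have := norm_sub_sub_smul_deriv_le hd1 hb1 hmem
    rw [hderiv] at this
    simp only [one_smul, zero_smul, add_zero, norm_one] at this
    refine this.trans_eq ?_
    rw [norm_pow, norm_norm]
    field_simp
  · simpa using Asymptotics.isLittleO_norm_pow_id one_lt_two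

/-! ### Conjugate exponents and Hölder duality -/

section CohenSumming

theorem conjExponent_ne_top {p : ℝ≥0∞} (hp : 1 < p) : p.conjExponent ≠ ∞ := by
  have : p - 1 ≠ 0 := (tsub_pos_of_lt hp).ne'
  simp [ENNReal.conjExponent, this]

theorem conjExponent_top : ENNReal.conjExponent ∞ = 1 := by
  simp [ENNReal.conjExponent]

theorem one_le_toReal_conjExponent {p : ℝ≥0∞} (hp : 1 < p) : 1 ≤ p.conjExponent.toReal := by
  rw [← ENNReal.toReal_one]
  exact ENNReal.toReal_mono (conjExponent_ne_top hp) le_self_add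

theorem holderConjugate_toReal_conjExponent {p : ℝ≥0∞} (hp : 1 < p) (hp' : p ≠ ∞) :
    p.toReal.HolderConjugate p.conjExponent.toReal :=
  haveI := ENNReal.HolderConjugate.conjExponent hp.le
  ENNReal.HolderConjugate.toReal_of_ne_top hp' (conjExponent_ne_top hp)

/-- **Hölder's inequality** for `ℓ_p^n`, including `p = ∞`. -/
theorem sum_norm_mul_le_norm_toLp_mul {p : ℝ≥0∞} (hp : 1 < p) {n : ℕ} (c : Fin n → ℂ)
    {a : Fin n → ℝ} (ha : ∀ i, 0 ≤ a i) :
    ∑ i, ‖c i‖ * a i ≤ ‖WithLp.toLp p c‖ *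
      (∑ i, a i ^ p.conjExponent.toReal) ^ (1 / p.conjExponent.toReal) := by
  rcases eq_or_ne p ∞ with rfl | hp'
  · simp only [conjExponent_top, ENNReal.toReal_one, Real.rpow_one, div_one, Finset.mul_sum]
    exact Finset.sum_le_sum fun i _ => mul_le_mul_of_nonneg_right
      (PiLp.norm_apply_le (WithLp.toLp ∞ c) i) (ha i)
  · have h := holderConjugate_toReal_conjExponent hp hp'
    have := Real.inner_le_Lp_mul_Lq Finset.univ (fun i => ‖c i‖) a h
    simpa [PiLp.norm_eq_sum h.pos, abs_of_nonneg, ha] using this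

/-- Converse of Hölder's inequality for `ℓ_p^n`. -/
theorem sum_rpow_le_of_forall_sum_norm_mul_le {p : ℝ≥0∞} (hp : 1 < p) {n : ℕ} {a : Fin n → ℝ}
    (ha : ∀ i, 0 ≤ a i) {B : ℝ} (hB : 0 ≤ B)
    (h : ∀ c : Fin n → ℂ, ∑ i, ‖c i‖ * a i ≤ ‖WithLp.toLp p c‖ * B) :
    ∑ i, a i ^ p.conjExponent.toReal ≤ B ^ p.conjExponent.toReal := by
  rcases eq_or_ne p ∞ with rfl | hp'
  · simp only [conjExponent_top, ENNReal.toReal_one, Real.rpow_one]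
    have h1 : ‖WithLp.toLp ∞ (fun _ : Fin n => (1 : ℂ))‖ ≤ 1 := by
      rw [PiLp.norm_eq_ciSup]
      exact Real.iSup_le (by simp) zero_le_one
    have h2 := h fun _ => 1
    simp only [norm_one, one_mul] at h2
    exact h2.trans (mul_le_of_le_one_left hB h1)
  · have hc := holderConjugate_toReal_conjExponent hp hp'
    set q := p.conjExponent.toReal
    set s := p.toReal with hs
    have hq : 0 < q := hc.symm.pos
    set T := ∑ i, a i ^ q with hT
    have hT0 : 0 ≤ T := Finset.sum_nonneg fun i _ => Real.rpow_nonneg (ha i) q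
    rcases hT0.eq_or_lt with hT0 | hT0
    · rw [← hT0]; positivity
    -- Equality case of Hölder: with `c i = a i ^ (q - 1)`, both `c i * a i` and `c i ^ s` equal `a
    -- i ^ q`, so `h` becomes `T ≤ T ^ (1 / s) * B`.
    have h1 := h fun i => ((a i ^ (q - 1) : ℝ) : ℂ)
    have e1 : ∀ i, ‖((a i ^ (q - 1) : ℝ) : ℂ)‖ = a i ^ (q - 1) := fun i => by
      rw [Complex.norm_real, Real.norm_of_nonneg (Real.rpow_nonneg (ha i) _)]
    have e2 : ∀ i, a i ^ (q - 1) * a i = a i ^ q := fun i => by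
      rcases (ha i).eq_or_lt with h0 | h0
      · rw [← h0, mul_zero, Real.zero_rpow hq.ne']
      · rw [← Real.rpow_add_one h0.ne', sub_add_cancel]
    have e3 : ∀ i, (a i ^ (q - 1)) ^ s = a i ^ q := fun i => by
      rw [← Real.rpow_mul (ha i)]
      congr 1
      exact hc.symm.sub_one_mul_conj
    rw [PiLp.norm_eq_sum hc.pos, ← hs] at h1
    simp only [e1, e2, e3] at h1
    rw [← hT] at h1
    have e4 : T ^ (1 / s) * T ^ (1 / q) = T := by
      rw [← Real.rpow_add hT0, one_div, one_div, hc.inv_add_inv_eq_one, Real.rpow_one]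
    have h2 : T ^ (1 / q) ≤ B := by
      have h3 : T ^ (1 / s) * T ^ (1 / q) ≤ T ^ (1 / s) * B := e4.trans_le h1
      exact le_of_mul_le_mul_left h3 (Real.rpow_pos_of_pos hT0 _)
    calc T = (T ^ (1 / q)) ^ q := by rw [one_div, Real.rpow_inv_rpow hT0.le hq.ne']
      _ ≤ B ^ q := by gcongr

/-! ### Evaluations on the dual ball and the weak norm -/

section

variable {X : Type*} [NormedAddCommGroup X] [NormedSpace ℂ X]

theorem continuous_dualBall_apply (y : X) : Continuous fun φ : DualBall X => φ.1 y :=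
  (iotaMap X y).continuous

theorem norm_dualBall_apply_le (φ : DualBall X) (y : X) : ‖φ.1 y‖ ≤ ‖y‖ := by
  rw [← (iotaMap X).norm_map y]
  exact (iotaMap X y).norm_coe_le_norm φ

instance : Nonempty (DualBall X) := ⟨⟨0, by simp [dualBallSet]⟩⟩

/-- The norm of `j_q (ι y)` in `L_q(μ)`, raised to the power `q`. -/
theorem norm_toLp_iotaMap_rpow {q : ℝ≥0∞} [Fact (1 ≤ q)] (hq : q ≠ ∞) (μ : Measure (DualBall X))
    [IsFiniteMeasure μ] (y : X) :
    ‖ContinuousMap.toLp q μ ℂ (iotaMap X y)‖ ^ q.toReal = ∫ φ, ‖φ.1 y‖ ^ q.toReal ∂μ := by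
  have hq0 : q ≠ 0 := (zero_lt_one.trans_le (Fact.out : 1 ≤ q)).ne'
  have hq1 : q.toReal ≠ 0 := (ENNReal.toReal_pos hq0 hq).ne'
  have hm := (Lp.memLp (ContinuousMap.toLp q μ ℂ (iotaMap X y))).ae_eq
    (ContinuousMap.coeFn_toLp μ (iotaMap X y))
  have h0 : 0 ≤ ∫ φ, ‖iotaMap X y φ‖ ^ q.toReal ∂μ :=
    integral_nonneg fun φ => Real.rpow_nonneg (norm_nonneg _) _
  rw [Lp.norm_def, eLpNorm_congr_ae (ContinuousMap.coeFn_toLp μ (iotaMap X y)),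
    hm.eLpNorm_eq_integral_rpow_norm hq0 hq, ENNReal.toReal_ofReal (by positivity),
    Real.rpow_inv_rpow h0 hq1]
  rfl

end

variable {E F : Type*} [NormedAddCommGroup E] [NormedSpace ℂ E]
  [NormedAddCommGroup F] [NormedSpace ℂ F]

/-- Needed because a real supremum over an unbounded family defaults to `0`. -/
theorem bddAbove_range_weakLpNorm {q : ℝ≥0∞} (hq : 0 < q.toReal) {n : ℕ}
    (y : Fin n → StrongDual ℂ F) :
    BddAbove (Set.range fun φ : DualBall (StrongDual ℂ F) =>
      ‖WithLp.toLp q (fun i => φ.1 (y i))‖) := by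
  refine ⟨(∑ i, ‖y i‖ ^ q.toReal) ^ (1 / q.toReal), ?_⟩
  rintro _ ⟨φ, rfl⟩
  simp only [PiLp.norm_eq_sum hq]
  gcongr with i
  exact norm_dualBall_apply_le φ (y i)

theorem weakLpNorm_nonneg (q : ℝ≥0∞) {n : ℕ} (y : Fin n → StrongDual ℂ F)
    (hq : 0 < q.toReal) : 0 ≤ weakLpNorm q y := by
  refine Real.iSup_nonneg fun φ => ?_
  rw [PiLp.norm_eq_sum hq]
  positivity

theorem sum_rpow_le_weakLpNorm_rpow {q : ℝ≥0∞} (hq : 0 < q.toReal) {n : ℕ}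
    (y : Fin n → StrongDual ℂ F) (φ : DualBall (StrongDual ℂ F)) :
    ∑ i, ‖φ.1 (y i)‖ ^ q.toReal ≤ weakLpNorm q y ^ q.toReal := by
  have h := le_ciSup (bddAbove_range_weakLpNorm hq y) φ
  simp only [PiLp.norm_eq_sum hq] at h
  have h0 : 0 ≤ ∑ i, ‖φ.1 (y i)‖ ^ q.toReal := by positivity
  calc _ = ((∑ i, ‖φ.1 (y i)‖ ^ q.toReal) ^ (1 / q.toReal)) ^ q.toReal := by
        rw [one_div, Real.rpow_inv_rpow h0 hq.ne']
    _ ≤ _ := by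
      refine Real.rpow_le_rpow (by positivity) (h.trans_eq ?_) hq.le
      simp only [weakLpNorm, PiLp.norm_eq_sum hq]

/-- The supremum in the weak norm is attained. -/
theorem exists_weakLpNorm_rpow_le {q : ℝ≥0∞} (hq : 0 < q.toReal) {n : ℕ}
    (y : Fin n → StrongDual ℂ F) :
    ∃ φ : DualBall (StrongDual ℂ F), weakLpNorm q y ^ q.toReal ≤ ∑ i, ‖φ.1 (y i)‖ ^ q.toReal := by
  have hc : Continuous fun φ : DualBall (StrongDual ℂ F) => ∑ i, ‖φ.1 (y i)‖ ^ q.toReal :=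
    continuous_finsetSum _ fun i _ =>
      (continuous_dualBall_apply (y i)).norm.rpow_const fun _ => Or.inr hq.le
  obtain ⟨φ, -, hφ⟩ := isCompact_univ.exists_isMaxOn Set.univ_nonempty hc.continuousOn
  refine ⟨φ, ?_⟩
  have h0 : 0 ≤ ∑ i, ‖φ.1 (y i)‖ ^ q.toReal := by positivity
  rw [← Real.rpow_inv_rpow h0 hq.ne']
  refine Real.rpow_le_rpow (weakLpNorm_nonneg q y hq) (ciSup_le fun ψ => ?_) hq.le
  rw [PiLp.norm_eq_sum hq, ← one_div]
  exact Real.rpow_le_rpow (by positivity) (hφ (Set.mem_univ ψ)) (by positivity)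

/-! ### Pietsch domination and its converse -/

omit [NormedAddCommGroup E] [NormedSpace ℂ E] in
/-- **Pietsch domination** for Cohen strongly `p`-summing mappings. -/
theorem IsCohenConst.exists_measure {p : ℝ≥0∞} (hp : 1 < p) {U : Set E} {f : E → F} {C : ℝ}
    (hC : IsCohenConst p U f C) :
    ∃ (μ : Measure (DualBall (StrongDual ℂ F))) (_ : IsProbabilityMeasure μ), μ.Regular ∧
      ∀ x ∈ U, ∀ y : StrongDual ℂ F, ‖y (f x)‖ ≤
        C * ‖ContinuousMap.toLp p.conjExponent μ ℂ (iotaMap (StrongDual ℂ F) y)‖ := by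
  set q := p.conjExponent with hqdef
  have hq : 0 < q.toReal := zero_lt_one.trans_le (one_le_toReal_conjExponent hp)
  have hC0 := hC.1
  let h : U × StrongDual ℂ F → C(DualBall (StrongDual ℂ F), ℝ) := fun a =>
    ⟨fun φ => C ^ q.toReal * ‖φ.1 a.2‖ ^ q.toReal - ‖a.2 (f a.1)‖ ^ q.toReal,
      (continuous_const.mul ((continuous_dualBall_apply a.2).norm.rpow_const
        fun _ => Or.inr hq.le)).sub continuous_const⟩
  obtain ⟨μ, hμ, hreg, hint⟩ := exists_probabilityMeasure_integral_nonneg h <| by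
    intro s w hw
    let e := s.equivFin.symm
    let x : Fin s.card → E := fun i => (e i).1.1
    -- The weights are absorbed into the functionals: scaling by `w ^ (1 / q)` multiplies `q`-th
    -- powers by `w`.
    let t : Fin s.card → ℝ := fun i => w (e i).1 ^ q.toReal⁻¹
    let y : Fin s.card → StrongDual ℂ F := fun i => (t i : ℂ) • (e i).1.2
    have ht : ∀ i, 0 ≤ t i := fun i => Real.rpow_nonneg (hw _) _
    have htq : ∀ i, t i ^ q.toReal = w (e i).1 := fun i => Real.rpow_inv_rpow (hw _) hq.ne'
    obtain ⟨φ, hφ⟩ := exists_weakLpNorm_rpow_le hq y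
    have hmain := sum_rpow_le_of_forall_sum_norm_mul_le hp (a := fun i => ‖y i (f (x i))‖)
      (fun i => norm_nonneg _) (mul_nonneg hC0 (weakLpNorm_nonneg q y hq)) fun c => by
        refine (hC.2 _ c x y fun i => (e i).1.1.2).trans_eq ?_
        ring
    rw [← hqdef, Real.mul_rpow hC0 (weakLpNorm_nonneg q y hq)] at hmain
    have hmain := hmain.trans (mul_le_mul_of_nonneg_left hφ (Real.rpow_nonneg hC0 _))
    refine ⟨φ, ?_⟩
    rw [← Finset.sum_coe_sort, ← e.sum_comp]
    have e1 : ∀ i, ‖y i (f (x i))‖ ^ q.toReal =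
        w (e i).1 * ‖(e i).1.2 (f (e i).1.1)‖ ^ q.toReal := fun i => by
      simp only [y, x, smul_apply, norm_smul, Complex.norm_real]
      rw [Real.norm_of_nonneg (ht i), Real.mul_rpow (ht i) (norm_nonneg _), htq]
    have e2 : ∀ i, ‖φ.1 (y i)‖ ^ q.toReal = w (e i).1 * ‖φ.1 (e i).1.2‖ ^ q.toReal := fun i => by
      have : φ.1 (y i) = (t i : ℂ) • φ.1 (e i).1.2 :=
        map_smul (WeakDual.toStrongDual φ.1) (t i : ℂ) (e i).1.2
      rw [this, norm_smul, Complex.norm_real,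
        Real.norm_of_nonneg (ht i), Real.mul_rpow (ht i) (norm_nonneg _), htq]
    simp only [e1, e2, Finset.mul_sum] at hmain
    rw [← sub_nonneg, ← Finset.sum_sub_distrib] at hmain
    refine hmain.trans_eq (Finset.sum_congr rfl fun i _ => ?_)
    simp only [h, ContinuousMap.coe_mk]
    ring
  refine ⟨μ, hμ, hreg, fun x hx y => ?_⟩
  have h1 := hint (⟨x, hx⟩, y)
  have hi : Integrable (fun φ : DualBall (StrongDual ℂ F) => ‖φ.1 y‖ ^ q.toReal) μ := by
    refine Continuous.integrable_of_hasCompactSupport ?_ (HasCompactSupport.of_compactSpace _)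
    exact (continuous_dualBall_apply y).norm.rpow_const fun _ => Or.inr hq.le
  simp only [h, ContinuousMap.coe_mk] at h1
  rw [integral_sub (hi.const_mul _) (integrable_const _), integral_const_mul,
    ← norm_toLp_iotaMap_rpow (conjExponent_ne_top hp)] at h1
  simp only [integral_const, probReal_univ, one_smul, sub_nonneg] at h1
  rw [← Real.mul_rpow hC0 (norm_nonneg _)] at h1
  exact (Real.rpow_le_rpow_iff (norm_nonneg _) (by positivity) hq).1 h1

theorem IsPietschFactorization.isCohenConst {p : ℝ≥0∞} (hp : 1 < p) {U : Set E} {f : E → F}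
    {μ : Measure (DualBall (StrongDual ℂ F))} {S : Submodule ℂ (Lp ℂ p.conjExponent μ)}
    {g : E → StrongDual ℂ S} (h : IsPietschFactorization p U f μ S g) :
    IsCohenConst p U f (supNorm U g) := by
  obtain ⟨hμ, -, hS, -, ⟨-, hbdd⟩, hfac⟩ := h
  have h0 : 0 ≤ supNorm U g := Real.iSup_nonneg fun x => norm_nonneg (g x)
  refine ⟨h0, fun n c x y hx => ?_⟩
  have hq : 0 < p.conjExponent.toReal := zero_lt_one.trans_le (one_le_toReal_conjExponent hp)
  let J := fun y => ContinuousMap.toLp p.conjExponent μ ℂ (iotaMap (StrongDual ℂ F) y)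
  have hbound : ∀ i, ‖y i (f (x i))‖ ≤ supNorm U g * ‖J (y i)‖ := by
    intro i
    have hg : ‖g (x i)‖ ≤ supNorm U g := by
      refine le_ciSup (f := fun x : U => ‖g x‖) ?_ ⟨x i, hx i⟩
      obtain ⟨M, hM⟩ := Bornology.IsBounded.exists_norm_le (E := StrongDual ℂ S) hbdd
      exact ⟨M, by rintro _ ⟨z, rfl⟩; exact hM _ ⟨z, z.2, rfl⟩⟩
    -- Evaluated at `y i`, the factorization reads `y i (f (x i)) = g (x i) (J (y i))`.
    have := congrArg (fun T => T (y i)) (hfac (x i) (hx i))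
    rw [NormedSpace.dual_def] at this
    rw [this]
    exact (g (x i)).le_of_opNorm_le hg _
  have hsum : (∑ i, ‖J (y i)‖ ^ p.conjExponent.toReal) ^ (1 / p.conjExponent.toReal) ≤ weakLpNorm p.conjExponent y := by
    have hi : ∀ i, Integrable (fun φ : DualBall (StrongDual ℂ F) => ‖φ.1 (y i)‖ ^ p.conjExponent.toReal) μ := by
      intro i
      refine Continuous.integrable_of_hasCompactSupport ?_ (HasCompactSupport.of_compactSpace _)
      exact (continuous_dualBall_apply (y i)).norm.rpow_const fun _ => Or.inr hq.le
    have : ∑ i, ‖J (y i)‖ ^ p.conjExponent.toReal ≤ weakLpNorm p.conjExponent y ^ p.conjExponent.toReal := by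
      simp only [J, norm_toLp_iotaMap_rpow (conjExponent_ne_top hp)]
      -- The integrand is pointwise at most the `q`-th power of the weak norm, and `μ` has mass one.
      rw [← integral_finsetSum _ fun i _ => hi i]
      calc _ ≤ ∫ _, weakLpNorm p.conjExponent y ^ p.conjExponent.toReal ∂μ :=
            integral_mono (integrable_finsetSum _ fun i _ => hi i) (integrable_const _)
              fun φ => sum_rpow_le_weakLpNorm_rpow hq y φ
        _ = _ := by simp
    calc _ ≤ (weakLpNorm p.conjExponent y ^ p.conjExponent.toReal) ^ (1 / p.conjExponent.toReal) := by gcongr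
      _ = _ := by rw [one_div, Real.rpow_rpow_inv (weakLpNorm_nonneg p.conjExponent y hq) hq.ne']
  calc ∑ i, ‖c i‖ * ‖y i (f (x i))‖ ≤ ∑ i, ‖c i‖ * (supNorm U g * ‖J (y i)‖) := by
        gcongr with i; exact hbound i
    _ = supNorm U g * ∑ i, ‖c i‖ * ‖J (y i)‖ := by
      rw [Finset.mul_sum]; exact Finset.sum_congr rfl fun i _ => by ring
    _ ≤ supNorm U g * (‖WithLp.toLp p c‖ * weakLpNorm p.conjExponent y) := by
      refine mul_le_mul_of_nonneg_left ?_ h0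
      refine (sum_norm_mul_le_norm_toLp_mul hp c fun i => norm_nonneg _).trans ?_
      have : Fact (1 ≤ p) := ⟨hp.le⟩
      exact mul_le_mul_of_nonneg_left hsum (norm_nonneg _)
    _ = _ := by ring

/-! ### Construction of the factorization -/

/-- Functionals extend from a dense subspace, linearly and without increasing the norm. -/
theorem exists_strongDual_extension {D V : Type*} [NormedAddCommGroup D] [NormedSpace ℂ D]
    [NormedAddCommGroup V] [NormedSpace ℂ V] (i : D →L[ℂ] V) (hi : DenseRange i)
    (hn : ∀ s, ‖s‖ ≤ ‖i s‖) :
    ∃ e : StrongDual ℂ D →L[ℂ] StrongDual ℂ V, (∀ ψ, ‖e ψ‖ ≤ ‖ψ‖) ∧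
      ∀ ψ s, e ψ (i s) = ψ s := by
  have hn' : ∀ s, ‖s‖ ≤ (1 : NNReal) * ‖i s‖ := by simpa using hn
  have hu : IsUniformInducing i := (i.isUniformEmbedding_of_bound hn').isUniformInducing
  have hle : ∀ ψ : StrongDual ℂ D, ‖ψ.extend i‖ ≤ ‖ψ‖ := fun ψ => by
    simpa using ψ.opNorm_extend_le hi hn'
  refine ⟨LinearMap.mkContinuous
    { toFun := fun ψ => ψ.extend i
      map_add' := fun a b => ContinuousLinearMap.extend_unique _ hi hu _ ?_
      map_smul' := fun c a => ContinuousLinearMap.extend_unique _ hi hu _ ?_ } 1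
      (fun ψ => by simpa using hle ψ), hle, fun ψ s => ?_⟩
  · ext s
    simp [ContinuousLinearMap.extend_eq _ hi hu]
  · ext s
    simp [ContinuousLinearMap.extend_eq _ hi hu]
  · exact ContinuousLinearMap.extend_eq ψ hi hu s

theorem IsCohenConst.exists_factorization {p : ℝ≥0∞} (hp : 1 < p) {U : Set E} (hU : IsOpen U)
    {f : E → F} (hf : DifferentiableOn ℂ f U) {C : ℝ} (hC : IsCohenConst p U f C) :
    ∃ (μ : Measure (DualBall (StrongDual ℂ F))) (S : Submodule ℂ (Lp ℂ p.conjExponent μ))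
      (g : E → StrongDual ℂ S), IsPietschFactorization p U f μ S g ∧ supNorm U g ≤ C := by
  obtain ⟨μ, hμ, hreg, hdom⟩ := hC.exists_measure hp
  let J : StrongDual ℂ F →ₗ[ℂ] Lp ℂ p.conjExponent μ :=
    ((ContinuousMap.toLp p.conjExponent μ ℂ).comp
      (iotaMap (StrongDual ℂ F)).toContinuousLinearMap).toLinearMap
  let D := LinearMap.range J
  let ev : E → StrongDual ℂ F →ₗ[ℂ] ℂ := fun x =>
    (NormedSpace.inclusionInDoubleDual ℂ F (f x)).toLinearMap
  -- `J` need not be injective; domination makes `J y ↦ y (f x)` well defined and bounded for `x ∈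
  -- U`.
  let g₀ : E → StrongDual ℂ D := fun x => (ev x).compLeftInverse J
  have hg₀ : ∀ x ∈ U, ∀ y, g₀ x ⟨J y, y, rfl⟩ = y (f x) := fun x hx y =>
    (ev x).compLeftInverse_apply_of_bdd J ⟨C, hdom x hx⟩ y _ rfl
  have hbd : ∀ x ∈ U, ‖g₀ x‖ ≤ C := by
    intro x hx
    refine ContinuousLinearMap.opNorm_le_bound _ hC.1 ?_
    rintro ⟨_, y, rfl⟩
    rw [hg₀ x hx]
    exact hdom x hx y
  have hdiff : DifferentiableOn ℂ g₀ U := by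
    refine differentiableOn_strongDual_of_apply hU hbd ?_
    rintro ⟨_, y, rfl⟩
    exact (y.differentiable.comp_differentiableOn hf).congr fun x hx => hg₀ x hx y
  let i : D →L[ℂ] D.topologicalClosure :=
    D.subtypeL.codRestrict _ fun s => D.le_topologicalClosure s.2
  have hi : DenseRange i :=
    (denseRange_inclusion_iff (s := (D : Set (Lp ℂ p.conjExponent μ)))
      (t := D.topologicalClosure) D.le_topologicalClosure).2 subset_rfl
  -- The extension is linear and continuous in the functional, so composing with it preserves
  -- holomorphy.
  obtain ⟨e, he, hext⟩ := exists_strongDual_extension i hi fun s => le_rfl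
  have hbd' : ∀ x ∈ U, ‖e (g₀ x)‖ ≤ C := fun x hx => (he _).trans (hbd x hx)
  refine ⟨μ, D.topologicalClosure, fun x => e (g₀ x), ⟨hμ, hreg, ?_, ?_, ⟨?_, ?_⟩, ?_⟩, ?_⟩
  · rintro ⟨_, y, rfl⟩
    exact D.le_topologicalClosure ⟨y, rfl⟩
  · exact D.isClosed_topologicalClosure
  · exact e.differentiable.comp_differentiableOn hdiff
  · refine (isBounded_iff_forall_norm_le (E := StrongDual ℂ D.topologicalClosure)).2 ⟨C, ?_⟩
    rintro _ ⟨x, hx, rfl⟩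
    exact hbd' x hx
  · intro x hx
    ext y
    exact ((hext (g₀ x) ⟨J y, y, rfl⟩).trans (hg₀ x hx y)).symm
  · exact Real.iSup_le (fun x => hbd' x x.2) hC.1

/-! ### Attainment of the infimum and the main theorem -/

omit [NormedAddCommGroup E] [NormedSpace ℂ E] in
/-- The infimum defining `d_p^{H^∞}(f)` is attained. -/
theorem isCohenConst_cohenNorm {p : ℝ≥0∞} {U : Set E} {f : E → F}
    (h : ∃ C, IsCohenConst p U f C) : IsCohenConst p U f (cohenNorm p U f) := by
  have hclosed : IsClosed {C : ℝ | IsCohenConst p U f C} := by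
    simp only [IsCohenConst, Set.ofPred_and, Set.ofPred_forall]
    refine isClosed_Ici.inter ?_
    refine isClosed_iInter fun n => isClosed_iInter fun c => isClosed_iInter fun x =>
      isClosed_iInter fun y => isClosed_iInter fun _ => ?_
    exact isClosed_le continuous_const (by fun_prop)
  exact hclosed.csInf_mem h ⟨0, fun C hC => hC.1⟩

omit [NormedAddCommGroup E] [NormedSpace ℂ E] in
theorem cohenNorm_le {p : ℝ≥0∞} {U : Set E} {f : E → F} {C : ℝ} (h : IsCohenConst p U f C) :
    cohenNorm p U f ≤ C :=
  csInf_le ⟨0, fun _ hC => hC.1⟩ h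

end CohenSumming

theorem mainTheorem6 {E F : Type*} [NormedAddCommGroup E] [NormedSpace ℂ E] [CompleteSpace E]
    [NormedAddCommGroup F] [NormedSpace ℂ F] [CompleteSpace F]
    (U : Set E) (hU : IsOpen U) (p : ℝ≥0∞) (hp : 1 < p) (f : E → F) (hf : IsHInfty U f) :
    (IsCohenStronglySumming p U f ↔
      ∃ (μ : Measure (DualBall (StrongDual ℂ F))) (S : Submodule ℂ (Lp ℂ p.conjExponent μ))
        (g : E → StrongDual ℂ S), IsPietschFactorization p U f μ S g) ∧
    (IsCohenStronglySumming p U f →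
      IsLeast {r : ℝ | ∃ (μ : Measure (DualBall (StrongDual ℂ F)))
          (S : Submodule ℂ (Lp ℂ p.conjExponent μ)) (g : E → StrongDual ℂ S),
          IsPietschFactorization p U f μ S g ∧ r = supNorm U g}
        (cohenNorm p U f)) := by
  refine ⟨⟨fun ⟨_, C, hC⟩ => ?_, fun ⟨μ, S, g, h⟩ => ⟨hf.1, _, h.isCohenConst hp⟩⟩,
    fun ⟨_, hC⟩ => ⟨?_, ?_⟩⟩
  · obtain ⟨μ, S, g, h, -⟩ := hC.exists_factorization hp hU hf.1
    exact ⟨μ, S, g, h⟩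
  -- Factoring with the optimal constant forces equality of norms.
  · obtain ⟨μ, S, g, h, hle⟩ := (isCohenConst_cohenNorm hC).exists_factorization hp hU hf.1
    exact ⟨μ, S, g, h, (cohenNorm_le (h.isCohenConst hp)).antisymm hle⟩
  · rintro _ ⟨μ, S, g, h, rfl⟩
    exact cohenNorm_le (h.isCohenConst hp)
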